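/- For integers $1\le N\le M$ let $\mathcal D_M=\{z\in\mathbb C: z^M=1\}$ and let $\mathbb P_{N,M}$ be the probability measure on $\mathcal D_M^N$ given by $$\mathbb P_{N,M}(z_1,\dots,z_N)=\frac1{Z_{N,M}}\prod_{1\le i<j\le N}|z_i-z_j|^2,\qquad Z_{N,M}=\sum_{z_1,\dots,z_N\in\mathcal D_M}\ \prod_{1\le i<j\le N}|z_i-z_j|^2 .$$ Let $(Z_j)_{j\ge1}$ be i.i.d. standard complex Gaussians, i.e. the real and imaginary parts of each $Z_j$ are independent centered real Gaussians of variance $1/2$. Let $(N_n)_n$ and $(M_n)_n$ be sequences of integers with $1\le N_n\le M_n$, $N_n\to\infty$ and $M_n-N_n\to\infty$ as $n\to\infty$. Then for every fixed integer $l\ge1$, with $(z_1,\dots,z_{N_n})$ distributed according to $\mathbb P_{N_n,M_n}$, $$\Bigl(\sum_{k=1}^{N_n}z_k,\ \sum_{k=1}^{N_n}z_k^2,\ \dots,\ \sum_{k=1}^{N_n}z_k^l\Bigr)\ \xrightarrow{d}\ \bigl(Z_1,\sqrt2\,Z_2,\dots,\sqrt l\,Z_l\bigr)\qquad\text{as }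 n\to\infty .$$ -/

import Mathlib

open MeasureTheory ProbabilityTheory Filter

/-- The discretized unit circle `D_M`: the zeros of `z ^ M - 1` in `ℂ`, for `M ≥ 1`. -/
noncomputable def discreteCircle (M : ℕ) : Finset ℂ :=
  Polynomial.nthRootsFinset M (1 : ℂ)

/-- The unnormalized density `∏_{i < j} |z_i - z_j|²` of the gas. -/
noncomputable def gasWeight {N M : ℕ} (z : Fin N → discreteCircle M) : ℝ :=
  ∏ i : Fin N, ∏ j ∈ Finset.Ioi i, ‖(z i : ℂ) - (z j : ℂ)‖ ^ 2

/-- The normalizing constant `Z_{N,M}`. -/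
noncomputable def gasPartition (N M : ℕ) : ℝ :=
  ∑ z : Fin N → discreteCircle M, gasWeight z

/-- The law of the gas as a measure: the configuration `z` has mass `gasWeight z / Z_{N,M}`. -/
noncomputable def discreteGasMeasure (N M : ℕ) : Measure (Fin N → discreteCircle M) :=
  ∑ z : Fin N → discreteCircle M,
    ENNReal.ofReal (gasWeight z / gasPartition N M) • Measure.dirac z

theorem mem_discreteCircle {M : ℕ} (hM : 0 < M) (z : ℂ) :
    z ∈ discreteCircle M ↔ z ^ M - 1 = 0 := by
  rw [discreteCircle, Polynomial.mem_nthRootsFinset hM, sub_eq_zero]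

theorem card_discreteCircle (M : ℕ) : (discreteCircle M).card = M := by
  rcases Nat.eq_zero_or_pos M with rfl | hM
  · simp [discreteCircle]
  · exact (Complex.isPrimitiveRoot_exp M hM.ne').card_nthRootsFinset

theorem gasWeight_nonneg {N M : ℕ} (z : Fin N → discreteCircle M) : 0 ≤ gasWeight z :=
  Finset.prod_nonneg fun _ _ => Finset.prod_nonneg fun _ _ => by positivity

theorem gasPartition_pos {N M : ℕ} (h : N ≤ M) : 0 < gasPartition N M := by
  have hc : Fintype.card (Fin N) ≤ Fintype.card (discreteCircle M) := by
    simpa [card_discreteCircle] using h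
  obtain ⟨e⟩ := Function.Embedding.nonempty_of_card_le hc
  refine Finset.sum_pos' (fun z _ => gasWeight_nonneg z) ⟨e, Finset.mem_univ _, ?_⟩
  refine Finset.prod_pos fun i _ => Finset.prod_pos fun j hj => ?_
  have hij : i ≠ j := (Finset.mem_Ioi.mp hj).ne
  have hne : ((e i : discreteCircle M) : ℂ) - (e j : discreteCircle M) ≠ 0 :=
    sub_ne_zero.mpr fun hh => hij (e.injective (Subtype.ext hh))
  have := norm_pos_iff.mpr hne
  positivity

theorem isProbabilityMeasure_discreteGasMeasure {N M : ℕ} (h : N ≤ M) :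
    IsProbabilityMeasure (discreteGasMeasure N M) := by
  constructor
  have hp := gasPartition_pos h
  simp only [discreteGasMeasure, Measure.coe_finsetSum, Finset.sum_apply, Measure.smul_apply,
    measure_univ, smul_eq_mul, mul_one]
  rw [← ENNReal.ofReal_sum_of_nonneg fun z _ => div_nonneg (gasWeight_nonneg z) hp.le,
    ← Finset.sum_div, ← gasPartition, div_self hp.ne', ENNReal.ofReal_one]

/-- The probability measure `ℙ_{N,M}` of the discrete log-gas on `D_M ^ N`, for `N ≤ M`. -/
noncomputable def discreteGas (N M : ℕ) (h : N ≤ M) :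
    ProbabilityMeasure (Fin N → discreteCircle M) :=
  ⟨discreteGasMeasure N M, isProbabilityMeasure_discreteGasMeasure h⟩

/-- The power sum `∑_k z_k ^ j`. -/
noncomputable def powerSum {N M : ℕ} (j : ℕ) (z : Fin N → discreteCircle M) : ℂ :=
  ∑ k : Fin N, (z k : ℂ) ^ j

/-- The standard complex Gaussian law: the real and imaginary parts are independent centered
real Gaussians of variance `1 / 2`. -/
noncomputable def stdComplexGaussian : Measure ℂ :=
  ((gaussianReal 0 (1 / 2)).prod (gaussianReal 0 (1 / 2))).map
    (fun p : ℝ × ℝ => (⟨p.1, p.2⟩ : ℂ))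

/-! The engine is a discrete loop (Schwinger–Dyson) equation. On `D_M` the sum of `z ^ n` vanishes
for `0 < |n| < M`, so the operator `z ∂/∂z` sends any Laurent polynomial of degree below `M` to a
function of sum zero. As `|w - u|² = 2 - w/u - u/w` on the circle, the gas weight has degree only `N
- 1` in each variable. Integration by parts against an observable of bounded degree is therefore
exact as soon as `M - N` is large, just as for Haar unitary eigenvalues.

Write `p_j` for the power sums and `X = ∑ 2 Re (c_j p_{j+1})`. Applying the operator to `z_i ^ (n+1)
X ^ m` times the weight and summing over `i` gives `integral_loop`: `N E[p_{n+1} X^m]` equals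
moments of power sums, in which the only explicit factor of order `N` is `p_0 = N`. A bootstrap on
the same equation bounds all moments (`integral_norm_powerSum_pow_le`). Dividing by `N` then leaves
`E[p_{k+1} X^m] ≈ m (k+1) conj(c_k) E[X^(m-1)]`, hence the Gaussian recursion `E[X^(m+1)] ≈ m σ²
E[X^(m-1)]` with `σ² = 2 ∑ (k+1) |c_k|²`.

Convergence of moments gives convergence of `E[exp(iX)]` by a Taylor bound. Since `X` ranges over
all real linear forms in the power sums, Lévy's continuity theorem gives joint convergence. -/

namespace LogGas

/-! ### Laurent polynomials on `D_M` and discrete integration by parts. -/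

/-- `LaurentPair M d f f'` says that `f` is the restriction to `D_M` of a Laurent polynomial with
exponents in `[-d, d]`, and that `f'` is the restriction of its image under `z ∂/∂z`. -/
inductive LaurentPair (M : ℕ) (d : ℕ) : (discreteCircle M → ℂ) → (discreteCircle M → ℂ) → Prop
  | zpow (a : ℂ) (n : ℤ) (h : n.natAbs ≤ d) :
      LaurentPair M d (fun z => a * (z : ℂ) ^ n) (fun z => a * (n * (z : ℂ) ^ n))
  | add {f f' g g' : discreteCircle M → ℂ} (hf : LaurentPair M d f f')
      (hg : LaurentPair M d g g') :
      LaurentPair M d (fun z => f z + g z) (fun z => f' z + g' z)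

theorem ne_zero_of_discreteCircle {M : ℕ} (z : discreteCircle M) : (z : ℂ) ≠ 0 := by
  rcases Nat.eq_zero_or_pos M with rfl | hM
  · have := z.2
    simp [discreteCircle] at this
  · have h := (mem_discreteCircle hM z).1 z.2
    intro h0
    rw [h0, zero_pow hM.ne'] at h
    norm_num at h

theorem norm_discreteCircle {M : ℕ} (z : discreteCircle M) : ‖(z : ℂ)‖ = 1 := by
  rcases Nat.eq_zero_or_pos M with rfl | hM
  · have := z.2
    simp [discreteCircle] at this
  · have h := (mem_discreteCircle hM z).1 z.2
    exact Complex.norm_eq_one_of_pow_eq_one (sub_eq_zero.1 h) hM.ne'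

theorem conj_discreteCircle {M : ℕ} (z : discreteCircle M) :
    (starRingEnd ℂ) (z : ℂ) = (z : ℂ)⁻¹ := by
  rw [Complex.inv_def, Complex.normSq_eq_norm_sq, norm_discreteCircle]
  simp

theorem sum_zpow_discreteCircle {M : ℕ} (n : ℤ) (hn : n ≠ 0) (hnM : n.natAbs < M) :
    ∑ z : discreteCircle M, (z : ℂ) ^ n = 0 := by
  have hM : 0 < M := by omega
  have hζ := Complex.isPrimitiveRoot_exp M hM.ne'
  set ζ := Complex.exp (2 * Real.pi * Complex.I / M)
  have hζ0 : ζ ≠ 0 := Complex.exp_ne_zero _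
  have hne : ζ ^ n ≠ 1 := by
    intro h
    have := (hζ.zpow_eq_one_iff_dvd n).1 h
    have := Int.natAbs_dvd_natAbs.2 this
    have := Nat.le_of_dvd (by omega) this
    simp at this
    omega
  have hmul : ∀ w : ℂ, w ^ M = 1 → ∀ z : discreteCircle M, w * z ∈ discreteCircle M := by
    intro w hw z
    have h := (mem_discreteCircle hM z).1 z.2
    rw [mem_discreteCircle hM, mul_pow, hw, one_mul, h]
  -- Rotation by a primitive root permutes `D_M` and multiplies the sum by `ζ ^ n ≠ 1`.
  have h1 : ∑ z : discreteCircle M, (z : ℂ) ^ n = ∑ z : discreteCircle M, (ζ * (z : ℂ)) ^ n := by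
    refine Finset.sum_bij' (fun z _ => ⟨ζ⁻¹ * z, hmul _ (by rw [inv_pow, hζ.pow_eq_one, inv_one]) z⟩)
      (fun z _ => ⟨ζ * z, hmul _ hζ.pow_eq_one z⟩) (by simp) (by simp) ?_ ?_ ?_
    · intro z _
      simp [mul_inv_cancel_left₀ hζ0]
    · intro z _
      simp [inv_mul_cancel_left₀ hζ0]
    · intro z _
      simp [mul_inv_cancel_left₀ hζ0]
  simp_rw [mul_zpow, ← Finset.mul_sum] at h1
  have h2 : (ζ ^ n - 1) * ∑ z : discreteCircle M, (z : ℂ) ^ n = 0 := by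
    rw [sub_mul, one_mul, ← h1, sub_self]
  exact (mul_eq_zero.1 h2).resolve_left (sub_ne_zero.2 hne)

namespace LaurentPair

variable {M d e : ℕ} {f f' g g' : discreteCircle M → ℂ}

/-- Discrete integration by parts: the derivation kills the constant term, and `d < M` keeps every
other exponent away from the multiples of `M`. -/
theorem sum_eq_zero (h : LaurentPair M d f f') (hd : d < M) : ∑ z, f' z = 0 := by
  induction h with
  | zpow a n h =>
    rcases eq_or_ne n 0 with rfl | hn
    · simp
    · simp_rw [← Finset.mul_sum]
      rw [sum_zpow_discreteCircle n hn (by omega)]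
      simp
  | add _ _ h1 h2 => rw [Finset.sum_add_distrib, h1, h2, add_zero]

theorem const (a : ℂ) : LaurentPair M d (fun _ => a) (fun _ => 0) := by
  simpa using LaurentPair.zpow (M := M) (d := d) a 0 (by simp)

theorem mul (hf : LaurentPair M d f f') (hg : LaurentPair M e g g') :
    LaurentPair M (d + e) (fun z => f z * g z) (fun z => f' z * g z + f z * g' z) := by
  induction hf with
  | zpow a n h =>
    induction hg with
    | zpow b m h' =>
      convert LaurentPair.zpow (M := M) (d := d + e) (a * b) (n + m) (by omega) using 2 with z z
      · rw [zpow_add₀ (ne_zero_of_discreteCircle z)]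
        ring
      · rw [zpow_add₀ (ne_zero_of_discreteCircle z)]
        push_cast
        ring
    | add _ _ h1 h2 =>
      convert h1.add h2 using 2 <;> ring
  | add _ _ h1 h2 =>
    convert h1.add h2 using 2 <;> ring

theorem const_mul (a : ℂ) (hf : LaurentPair M d f f') :
    LaurentPair M d (fun z => a * f z) (fun z => a * f' z) := by
  simpa using (LaurentPair.const (d := 0) a).mul hf

theorem sum {ι : Type*} (s : Finset ι) {f f' : ι → discreteCircle M → ℂ}
    (h : ∀ i ∈ s, LaurentPair M d (f i) (f' i)) :
    LaurentPair M d (fun z => ∑ i ∈ s, f i z) (fun z => ∑ i ∈ s, f' i z) := by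
  classical
  induction s using Finset.induction_on with
  | empty => simpa using LaurentPair.const 0
  | insert a s ha ih =>
    simp_rw [Finset.sum_insert ha]
    exact (h a (by simp)).add (ih fun i hi => h i (by simp [hi]))

/-- Leibniz rule in logarithmic form: `r i` plays the role of the logarithmic derivative of `f i`,
and these add up. -/
theorem prod {ι : Type*} (s : Finset ι) {f r : ι → discreteCircle M → ℂ} {d : ι → ℕ}
    (h : ∀ i ∈ s, LaurentPair M (d i) (f i) (fun z => f i z * r i z)) :
    LaurentPair M (∑ i ∈ s, d i) (fun z => ∏ i ∈ s, f i z)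
      (fun z => (∏ i ∈ s, f i z) * ∑ i ∈ s, r i z) := by
  classical
  induction s using Finset.induction_on with
  | empty => simpa using LaurentPair.const 1
  | insert a s ha ih =>
    simp_rw [Finset.sum_insert ha, Finset.prod_insert ha]
    convert (h a (by simp)).mul (ih fun i hi => h i (by simp [hi])) using 2
    ring

theorem pow (hf : LaurentPair M d f f') (m : ℕ) :
    LaurentPair M (m * d) (fun z => f z ^ m) (fun z => m * f z ^ (m - 1) * f' z) := by
  induction m with
  | zero => simpa using LaurentPair.const 1
  | succ m ih =>
    convert (ih.mul hf) using 2 with z z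
    · ring
    · exact pow_succ _ _
    · rcases m with _ | m
      · simp
      · push_cast
        ring

end LaurentPair

/-- The power sum `∑_k z_k ^ j` with an integer exponent. -/
noncomputable def zpowSum {N M : ℕ} (j : ℤ) (z : Fin N → discreteCircle M) : ℂ :=
  ∑ k : Fin N, (z k : ℂ) ^ j

/-! ### The loop equation for sums over configurations. -/

section loop

variable {N M : ℕ}

/-- Exchanging `z i` with an independent site `w` is an involution of the pairs `(z, w)`, so
resampling one coordinate only multiplies the total by `M`. -/
theorem sum_eq_zero_of_sum_update (i : Fin N) (G : (Fin N → discreteCircle M) → ℂ)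
    (h : ∀ z, ∑ w, G (Function.update z i w) = 0) : ∑ z, G z = 0 := by
  rcases Nat.eq_zero_or_pos M with rfl | hM
  · have : IsEmpty (Fin N → discreteCircle 0) := ⟨fun z => by
      have := (z i).2
      simp [discreteCircle] at this⟩
    simp
  have h1 : ∑ p : (Fin N → discreteCircle M) × discreteCircle M,
      G (Function.update p.1 i p.2) = ∑ p : (Fin N → discreteCircle M) × discreteCircle M,
      G p.1 := by
    refine Finset.sum_bij' (fun p _ => (Function.update p.1 i p.2, p.1 i))
      (fun p _ => (Function.update p.1 i p.2, p.1 i)) (by simp) (by simp) ?_ ?_ ?_ <;> simp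
  rw [Fintype.sum_prod_type, Fintype.sum_prod_type] at h1
  simp only [h, Finset.sum_const_zero, Finset.sum_const, Finset.card_univ, Fintype.card_coe,
    card_discreteCircle, ← Finset.smul_sum] at h1
  have h2 := h1.symm
  rw [nsmul_eq_mul, mul_eq_zero] at h2
  exact h2.resolve_left (by exact_mod_cast hM.ne')

/-- Each `j ≠ i` meets `i` in exactly one ordered pair. This serves twice: for the degree of the
weight (`g = 1`) and for its logarithmic derivative. -/
theorem sum_pairs_indicator {R : Type*} [AddCommMonoid R] (i : Fin N) (g : Fin N → R) :
    ∑ a, ∑ b ∈ Finset.Ioi a, ((if a = i then g b else 0) + (if b = i then g a else 0))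
      = ∑ j ∈ Finset.univ.erase i, g j := by
  have h : Finset.univ.erase i = Finset.Ioi i ∪ Finset.univ.filter (· < i) := by
    ext j
    simp only [Finset.mem_erase, Finset.mem_univ, and_true, Finset.mem_union, Finset.mem_Ioi,
      Finset.mem_filter, true_and]
    rw [or_comm]
    exact ne_iff_lt_or_gt
  rw [h, Finset.sum_union]
  · simp_rw [Finset.sum_add_distrib]
    congr 1
    · rw [Finset.sum_eq_single i]
      · simp
      · intro b _ hb
        simp [hb]
      · simp
    · rw [Finset.sum_filter]
      refine Finset.sum_congr rfl fun a _ => ?_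
      rw [Finset.sum_ite_eq' (Finset.Ioi a) i]
      simp
  · rw [Finset.disjoint_left]
    intro a ha
    simp only [Finset.mem_Ioi] at ha
    simp [ha.le]

theorem laurentPair_dist (u : discreteCircle M) :
    LaurentPair M 1 (fun w => ((‖(w : ℂ) - u‖ ^ 2 : ℝ) : ℂ))
      (fun w => ((‖(w : ℂ) - u‖ ^ 2 : ℝ) : ℂ) * (((w : ℂ) + u) / ((w : ℂ) - u))) := by
  have hu := ne_zero_of_discreteCircle u
  have key : ∀ w : discreteCircle M, ((‖(w : ℂ) - u‖ ^ 2 : ℝ) : ℂ) =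
      2 + (-(u : ℂ)⁻¹ * (w : ℂ) ^ (1 : ℤ) + -(u : ℂ) * (w : ℂ) ^ (-1 : ℤ)) := by
    intro w
    have hw := ne_zero_of_discreteCircle w
    rw [← Complex.normSq_eq_norm_sq, ← Complex.mul_conj, map_sub, conj_discreteCircle,
      conj_discreteCircle]
    simp only [zpow_one, zpow_neg]
    field_simp
    ring
  have := (LaurentPair.const (M := M) (d := 1) 2).add ((LaurentPair.zpow (-(u : ℂ)⁻¹) 1
    (by simp)).add (LaurentPair.zpow (-(u : ℂ)) (-1) (by simp)))
  convert this using 2 with w w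
  · exact key w
  · rw [key w]
    have hw := ne_zero_of_discreteCircle w
    -- At `w = u` the quotient is `0` by convention, and the true derivative `u/w - w/u` vanishes
    -- too, so the formula needs no exception.
    rcases eq_or_ne (w : ℂ) u with h | h
    · rw [h]
      simp only [zpow_one, zpow_neg]
      field_simp
      push_cast
      ring
    · have := sub_ne_zero.2 h
      simp only [zpow_one, zpow_neg]
      push_cast
      field_simp
      ring

theorem laurentPair_gasWeight (z : Fin N → discreteCircle M) (i : Fin N) :
    LaurentPair M (N - 1) (fun w => (gasWeight (Function.update z i w) : ℂ))
      (fun w => (gasWeight (Function.update z i w) : ℂ) *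
        ∑ j ∈ Finset.univ.erase i, ((w : ℂ) + z j) / ((w : ℂ) - z j)) := by
  have h : ∀ a b : Fin N, a < b →
      LaurentPair M ((if a = i then 1 else 0) + (if b = i then 1 else 0))
      (fun w => ((‖(Function.update z i w a : ℂ) - (Function.update z i w b : ℂ)‖ ^ 2 : ℝ) : ℂ))
      (fun w => ((‖(Function.update z i w a : ℂ) - (Function.update z i w b : ℂ)‖ ^ 2 : ℝ) : ℂ) *
        ((if a = i then ((w : ℂ) + z b) / ((w : ℂ) - z b) else 0) +
          (if b = i then ((w : ℂ) + z a) / ((w : ℂ) - z a) else 0))) := by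
    intro a b hab
    by_cases ha : a = i
    · subst ha
      have hb : b ≠ a := hab.ne'
      simpa [hb] using laurentPair_dist (z b)
    · by_cases hb : b = i
      · subst hb
        simpa [ha, norm_sub_rev (z a : ℂ)] using laurentPair_dist (z a)
      · simpa [ha, hb] using LaurentPair.const (M := M) (d := 0) _
  have h2 := LaurentPair.prod Finset.univ fun a _ =>
    LaurentPair.prod (Finset.Ioi a) fun b hb => h a b (Finset.mem_Ioi.1 hb)
  rw [sum_pairs_indicator i (fun _ => 1)] at h2
  have h3 (w : discreteCircle M) :=
    sum_pairs_indicator i (fun b => ((w : ℂ) + z b) / ((w : ℂ) - z b))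
  simp_rw [h3] at h2
  simpa [gasWeight] using h2

theorem injective_of_gasWeight_ne_zero {z : Fin N → discreteCircle M} (h : gasWeight z ≠ 0) :
    Function.Injective fun i => (z i : ℂ) := by
  have key : ∀ a b, a < b → (z a : ℂ) ≠ z b := by
    intro a b hab heq
    refine h (Finset.prod_eq_zero (Finset.mem_univ a)
      (Finset.prod_eq_zero (Finset.mem_Ioi.2 hab) ?_))
    simp [heq]
  intro a b hab
  rcases lt_trichotomy a b with h1 | h1 | h1
  · exact absurd hab (key a b h1)
  · exact h1
  · exact absurd hab.symm (key b a h1)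

theorem pow_sub_pow_mul_add (x y : ℂ) (n : ℕ) :
    (x ^ (n + 1) - y ^ (n + 1)) * (x + y) = (x ^ (n + 1) + y ^ (n + 1) +
      2 * ∑ a ∈ Finset.range n, x ^ (a + 1) * y ^ (n - a)) * (x - y) := by
  have h := (Commute.all x y).geom_sum₂_mul (n + 1)
  have h1 : x * ∑ i ∈ Finset.range (n + 1), x ^ i * y ^ (n + 1 - 1 - i) =
      x ^ (n + 1) + ∑ a ∈ Finset.range n, x ^ (a + 1) * y ^ (n - a) := by
    rw [Finset.sum_range_succ, mul_add, Finset.mul_sum, add_comm]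
    congr 1
    · simp [pow_succ']
    · refine Finset.sum_congr rfl fun a _ => ?_
      rw [add_tsub_cancel_right]
      ring
  have h2 : y * ∑ i ∈ Finset.range (n + 1), x ^ i * y ^ (n + 1 - 1 - i) =
      y ^ (n + 1) + ∑ a ∈ Finset.range n, x ^ (a + 1) * y ^ (n - a) := by
    rw [Finset.sum_range_succ', mul_add, Finset.mul_sum, add_comm]
    congr 1
    · simp [pow_succ']
    · refine Finset.sum_congr rfl fun a ha => ?_
      have : n - a = n + 1 - 1 - (a + 1) + 1 := by
        have := Finset.mem_range.1 ha
        omega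
      rw [this]
      ring
  linear_combination (-(x + y)) * h + (x - y) * h1 + (x - y) * h2

/-- Symmetrization: `(x i + x j) / (x i - x j)` is antisymmetric, so adding the terms `(i, j)` and
`(j, i)` produces a difference quotient, which is a polynomial. -/
theorem sum_ratio {x : Fin N → ℂ} (hx : Function.Injective x) (n : ℕ) :
    ∑ i, ∑ j ∈ Finset.univ.erase i, x i ^ (n + 1) * ((x i + x j) / (x i - x j)) =
      (N - (n + 1)) * ∑ i, x i ^ (n + 1) +
        ∑ a ∈ Finset.range n, (∑ i, x i ^ (a + 1)) * ∑ i, x i ^ (n - a) := by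
  set T : Fin N → Fin N → ℂ := fun i j => x i ^ (n + 1) + x j ^ (n + 1) +
      2 * ∑ a ∈ Finset.range n, x i ^ (a + 1) * x j ^ (n - a) with hT
  set r : Fin N → Fin N → ℂ := fun i j => x i ^ (n + 1) * ((x i + x j) / (x i - x j)) with hr
  have h1 : ∑ i, ∑ j ∈ Finset.univ.erase i, r i j = ∑ i, ∑ j, r i j :=
    Finset.sum_congr rfl fun i _ => Finset.sum_erase _ (by simp [hr])
  have h2 : ∑ i, ∑ j, r i j = ∑ i, ∑ j, r j i := Finset.sum_comm
  -- On the diagonal `r` is `0` by the division convention while the polynomial `T i i` is `2 (n +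
  -- 1) x i ^ (n + 1)`; this correction produces `N - (n + 1)`.
  have h3 : ∀ i j, r i j + r j i = T i j - if i = j then 2 * (n + 1) * x i ^ (n + 1) else 0 := by
    intro i j
    rcases eq_or_ne i j with rfl | hij
    · have : ∑ a ∈ Finset.range n, x i ^ (a + 1) * x i ^ (n - a) = n * x i ^ (n + 1) := by
        rw [Finset.sum_congr rfl (g := fun _ => x i ^ (n + 1)), Finset.sum_const,
          Finset.card_range, nsmul_eq_mul]
        intro a ha
        rw [← pow_add]
        congr 1
        have := Finset.mem_range.1 ha
        omega
      simp only [hr, hT, sub_self, div_zero, mul_zero, this, if_true]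
      ring
    · have hne : x i - x j ≠ 0 := sub_ne_zero.2 fun h => hij (hx h)
      have hne' : x j - x i ≠ 0 := sub_ne_zero.2 fun h => hij (hx h).symm
      have hT' : T i j = (x i ^ (n + 1) - x j ^ (n + 1)) * (x i + x j) / (x i - x j) := by
        rw [pow_sub_pow_mul_add, mul_div_cancel_right₀ _ hne]
      rw [hT', if_neg hij]
      simp only [hr]
      rw [← neg_sub (x i) (x j)]
      field_simp
      ring
  have h4 : ∑ i, ∑ j, T i j = 2 * (N * ∑ i, x i ^ (n + 1)) +
      2 * ∑ a ∈ Finset.range n, (∑ i, x i ^ (a + 1)) * ∑ i, x i ^ (n - a) := by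
    simp_rw [hT, Finset.sum_add_distrib, ← Finset.mul_sum]
    congr 1
    · simp [← Finset.mul_sum]
      ring
    · congr 1
      simp_rw [Finset.sum_mul_sum]
      rw [Finset.sum_comm (s := Finset.range n)]
      exact Finset.sum_congr rfl fun i _ => Finset.sum_comm
  have h5 : 2 * ∑ i, ∑ j, r i j = ∑ i, ∑ j, (r i j + r j i) := by
    simp_rw [Finset.sum_add_distrib]
    rw [← h2]
    ring
  simp_rw [h3, Finset.sum_sub_distrib] at h5
  rw [h4] at h5
  simp only [Finset.sum_ite_eq, Finset.mem_univ, if_true, ← Finset.mul_sum] at h5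
  rw [h1]
  linear_combination h5 / 2

theorem sum_gasWeight_loop {n d : ℕ} (h : n + 1 + d + N ≤ M)
    {F : (Fin N → discreteCircle M) → ℂ} {F' : Fin N → (Fin N → discreteCircle M) → ℂ}
    (hF : ∀ i z, LaurentPair M d (fun w => F (Function.update z i w))
      (fun w => F' i (Function.update z i w))) :
    ∑ z : Fin N → discreteCircle M, (gasWeight z : ℂ) * (N * powerSum (n + 1) z * F z +
      (∑ a ∈ Finset.range n, powerSum (a + 1) z * powerSum (n - a) z) * F z +
      ∑ i, (z i : ℂ) ^ (n + 1) * F' i z) = 0 := by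
  have h1 : ∀ i : Fin N, ∑ z : Fin N → discreteCircle M, (gasWeight z : ℂ) *
      ((n + 1) * (z i : ℂ) ^ (n + 1) * F z + (z i : ℂ) ^ (n + 1) * F' i z +
        F z * ∑ j ∈ Finset.univ.erase i,
          (z i : ℂ) ^ (n + 1) * (((z i : ℂ) + z j) / ((z i : ℂ) - z j))) = 0 := by
    intro i
    refine sum_eq_zero_of_sum_update i _ fun z => ?_
    have hp := ((LaurentPair.zpow (M := M) (d := n + 1) 1 ((n + 1 : ℕ) : ℤ)
      (Int.natAbs_natCast _).le).mul
      (hF i z)).mul (laurentPair_gasWeight z i)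
    have hN : 0 < N := i.pos
    -- The total degree `(n + 1) + d + (N - 1)` is less than `M`.
    rw [← hp.sum_eq_zero (by omega)]
    refine Finset.sum_congr rfl fun w _ => ?_
    have : ∑ j ∈ Finset.univ.erase i, (Function.update z i w i : ℂ) ^ (n + 1) *
        (((Function.update z i w i : ℂ) + Function.update z i w j) /
          ((Function.update z i w i : ℂ) - Function.update z i w j)) =
        (w : ℂ) ^ (n + 1) * ∑ j ∈ Finset.univ.erase i, (((w : ℂ) + z j) / ((w : ℂ) - z j)) := by
      rw [Finset.mul_sum]
      refine Finset.sum_congr rfl fun j hj => ?_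
      rw [Function.update_self, Function.update_of_ne (Finset.ne_of_mem_erase hj)]
    rw [this, Function.update_self, zpow_natCast]
    push_cast
    ring
  have h2 := Finset.sum_eq_zero fun i (_ : i ∈ Finset.univ) => h1 i
  rw [Finset.sum_comm] at h2
  rw [← h2]
  refine Finset.sum_congr rfl fun z _ => ?_
  rw [← Finset.mul_sum]
  -- Configurations with coinciding points carry no weight, so the symmetrization is needed only for
  -- distinct points.
  rcases eq_or_ne (gasWeight z) 0 with h0 | h0
  · simp [h0]
  · congr 1
    simp_rw [Finset.sum_add_distrib, ← Finset.mul_sum, ← Finset.sum_mul, ← Finset.mul_sum]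
    have hs := sum_ratio (injective_of_gasWeight_ne_zero h0) n
    simp only [← Finset.mul_sum] at hs
    rw [hs]
    simp only [powerSum]
    ring

end loop
end LogGas

namespace LogGas

/-! ### The loop equation as an identity between moments. -/

section moments

variable {N M : ℕ}

/-- The law of the discrete log-gas as a bare measure. -/
noncomputable abbrev gasLaw (N M : ℕ) (h : N ≤ M) : Measure (Fin N → discreteCircle M) :=
  (discreteGas N M h : Measure (Fin N → discreteCircle M))

theorem integrable_discreteGas {E : Type*} [NormedAddCommGroup E] (h : N ≤ M)
    (f : (Fin N → discreteCircle M) → E) : Integrable f (gasLaw N M h) :=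
  Integrable.of_finite

theorem integral_discreteGas (h : N ≤ M) (f : (Fin N → discreteCircle M) → ℂ) :
    ∫ z, f z ∂(gasLaw N M h) =
      ((gasPartition N M : ℝ) : ℂ)⁻¹ * ∑ z, (gasWeight z : ℂ) * f z := by
  have h1 : gasLaw N M h = discreteGasMeasure N M := rfl
  rw [h1, discreteGasMeasure, integral_finsetSum_measure]
  · rw [Finset.mul_sum]
    refine Finset.sum_congr rfl fun z _ => ?_
    rw [integral_smul_measure, integral_dirac, ENNReal.toReal_ofReal
      (div_nonneg (gasWeight_nonneg z) (gasPartition_pos h).le), Complex.real_smul]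
    push_cast
    ring
  · intro z _
    exact (integrable_dirac (by simp)).smul_measure (by simp)

/-- The real linear form `∑_j 2 Re (c_j p_{j+1})` in the power sums. -/
noncomputable def linForm {l : ℕ} (c : Fin l → ℂ) (z : Fin N → discreteCircle M) : ℝ :=
  ∑ j : Fin l, 2 * (c j * powerSum (j + 1) z).re

theorem conj_powerSum (k : ℕ) (z : Fin N → discreteCircle M) :
    (starRingEnd ℂ) (powerSum k z) = zpowSum (-(k : ℤ)) z := by
  simp [powerSum, zpowSum, conj_discreteCircle]

theorem powerSum_eq_zpowSum (k : ℕ) (z : Fin N → discreteCircle M) :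
    powerSum k z = zpowSum k z := by
  simp [powerSum, zpowSum]

theorem norm_zpowSum_le (k : ℤ) (z : Fin N → discreteCircle M) : ‖zpowSum k z‖ ≤ N := by
  refine (norm_sum_le _ _).trans ?_
  simp [norm_discreteCircle]

theorem norm_powerSum_le (k : ℕ) (z : Fin N → discreteCircle M) : ‖powerSum k z‖ ≤ N := by
  rw [powerSum_eq_zpowSum]
  exact norm_zpowSum_le _ _

theorem norm_zpowSum_eq (k : ℤ) (z : Fin N → discreteCircle M) :
    ‖zpowSum k z‖ = ‖powerSum k.natAbs z‖ := by
  rcases Int.natAbs_eq k with h | h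
  · rw [powerSum_eq_zpowSum, ← h]
  · rw [← Complex.norm_conj (powerSum _ z), conj_powerSum, ← h]

theorem zpowSum_zero (z : Fin N → discreteCircle M) : zpowSum 0 z = N := by
  simp [zpowSum]

theorem ofReal_linForm {l : ℕ} (c : Fin l → ℂ) (z : Fin N → discreteCircle M) :
    (linForm c z : ℂ) = ∑ j : Fin l, (c j * zpowSum ((j : ℕ) + 1 : ℕ) z +
      (starRingEnd ℂ) (c j) * zpowSum (-((j : ℕ) + 1 : ℕ)) z) := by
  rw [linForm]
  push_cast
  refine Finset.sum_congr rfl fun j _ => ?_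
  have := Complex.add_conj (c j * powerSum (j + 1) z)
  rw [map_mul, conj_powerSum, powerSum_eq_zpowSum] at this
  rw [powerSum_eq_zpowSum]
  push_cast at this ⊢
  exact this.symm

theorem laurentPair_zpowSum (k : ℤ) {d : ℕ} (hd : k.natAbs ≤ d) (i : Fin N)
    (z : Fin N → discreteCircle M) :
    LaurentPair M d (fun w => zpowSum k (Function.update z i w)) (fun w => k * (w : ℂ) ^ k) := by
  have h := LaurentPair.sum (M := M) (d := d) Finset.univ
    (f := fun j w => (Function.update z i w j : ℂ) ^ k)
    (f' := fun j w => if j = i then k * (w : ℂ) ^ k else 0) fun j _ => by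
      by_cases hj : j = i
      · subst hj
        simpa using LaurentPair.zpow (M := M) 1 k hd
      · simpa [hj] using LaurentPair.const (M := M) (d := d) _
  simp_rw [zpowSum]
  simpa using h

/-- The image of `linForm c` under `z_i ∂/∂z_i`. -/
noncomputable def linFormDeriv {l : ℕ} (c : Fin l → ℂ) (i : Fin N)
    (z : Fin N → discreteCircle M) : ℂ :=
  ∑ j : Fin l, ((j : ℂ) + 1) * (c j * (z i : ℂ) ^ ((j : ℕ) + 1 : ℤ) -
    (starRingEnd ℂ) (c j) * (z i : ℂ) ^ (-((j : ℕ) + 1 : ℤ)))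

theorem laurentPair_linForm {l : ℕ} (c : Fin l → ℂ) (i : Fin N)
    (z : Fin N → discreteCircle M) :
    LaurentPair M l (fun w => (linForm c (Function.update z i w) : ℂ))
      (fun w => linFormDeriv c i (Function.update z i w)) := by
  have h := LaurentPair.sum (M := M) (d := l) Finset.univ fun (j : Fin l) _ =>
    ((laurentPair_zpowSum ((j : ℕ) + 1 : ℕ) (d := l) (by have := j.2; omega) i z).const_mul
      (c j)).add ((laurentPair_zpowSum (-((j : ℕ) + 1 : ℕ)) (d := l)
        (by have := j.2; omega) i z).const_mul ((starRingEnd ℂ) (c j)))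
  simp_rw [ofReal_linForm, linFormDeriv]
  convert h using 2 with w
  refine Finset.sum_congr rfl fun j _ => ?_
  rw [Function.update_self]
  push_cast
  ring

theorem sum_pow_mul_linFormDeriv {l : ℕ} (c : Fin l → ℂ) (n : ℕ)
    (z : Fin N → discreteCircle M) :
    ∑ i, (z i : ℂ) ^ (n + 1) * linFormDeriv c i z = ∑ j : Fin l, ((j : ℂ) + 1) *
      (c j * powerSum (n + 1 + (j + 1)) z - (starRingEnd ℂ) (c j) * zpowSum (n - (j : ℕ)) z) := by
  simp_rw [linFormDeriv, Finset.mul_sum]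
  rw [Finset.sum_comm]
  refine Finset.sum_congr rfl fun j _ => ?_
  rw [powerSum, zpowSum, Finset.mul_sum, Finset.mul_sum, ← Finset.sum_sub_distrib, Finset.mul_sum]
  refine Finset.sum_congr rfl fun i _ => ?_
  have h0 := ne_zero_of_discreteCircle (z i)
  have h1 : (z i : ℂ) ^ (n + 1) * (z i : ℂ) ^ ((j : ℕ) + 1 : ℤ) =
      (z i : ℂ) ^ (n + 1 + ((j : ℕ) + 1)) := by
    rw [pow_add _ (n + 1)]
    norm_cast
  have h2 : (z i : ℂ) ^ (n + 1) * (z i : ℂ) ^ (-((j : ℕ) + 1 : ℤ)) =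
      (z i : ℂ) ^ ((n : ℤ) - (j : ℕ)) := by
    rw [← zpow_natCast, ← zpow_add₀ h0]
    congr 1
    push_cast
    ring
  linear_combination ((j : ℂ) + 1) * c j * h1 - ((j : ℂ) + 1) * (starRingEnd ℂ) (c j) * h2

/-- The loop equation for `F = X ^ m`, with degree `d = m * l`. The term `j = n` contains `zpowSum 0
= N`, which becomes the covariance in the limit. -/
theorem integral_loop {l n m : ℕ} (h : N ≤ M) (hm : n + 1 + m * l + N ≤ M) (c : Fin l → ℂ) :
    N * ∫ z, powerSum (n + 1) z * (linForm c z : ℂ) ^ m ∂(gasLaw N M h) =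
      - (∑ a ∈ Finset.range n, ∫ z, powerSum (a + 1) z * powerSum (n - a) z *
          (linForm c z : ℂ) ^ m ∂(gasLaw N M h)) +
      m * ∑ j : Fin l, ((j : ℂ) + 1) *
        ((starRingEnd ℂ) (c j) * (∫ z, zpowSum (n - (j : ℕ)) z * (linForm c z : ℂ) ^ (m - 1)
            ∂(gasLaw N M h)) -
          c j * ∫ z, powerSum (n + 1 + (j + 1)) z * (linForm c z : ℂ) ^ (m - 1)
            ∂(gasLaw N M h)) := by
  have h1 := sum_gasWeight_loop (F := fun z => (linForm c z : ℂ) ^ m)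
    (F' := fun i z => m * (linForm c z : ℂ) ^ (m - 1) * linFormDeriv c i z) hm fun i z =>
    (laurentPair_linForm c i z).pow m
  have h2 : ∀ z : Fin N → discreteCircle M, ∑ i, (z i : ℂ) ^ (n + 1) *
      (m * (linForm c z : ℂ) ^ (m - 1) * linFormDeriv c i z) =
      m * (linForm c z : ℂ) ^ (m - 1) * ∑ j : Fin l, ((j : ℂ) + 1) *
      (c j * powerSum (n + 1 + (j + 1)) z - (starRingEnd ℂ) (c j) * zpowSum (n - (j : ℕ)) z) := by
    intro z
    rw [← sum_pow_mul_linFormDeriv, Finset.mul_sum]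
    exact Finset.sum_congr rfl fun i _ => by ring
  have h3 : ∫ z, (N * (powerSum (n + 1) z * (linForm c z : ℂ) ^ m) +
      ∑ a ∈ Finset.range n, powerSum (a + 1) z * powerSum (n - a) z * (linForm c z : ℂ) ^ m +
      m * ∑ j : Fin l, ((j : ℂ) + 1) *
        (c j * (powerSum (n + 1 + (j + 1)) z * (linForm c z : ℂ) ^ (m - 1)) -
          (starRingEnd ℂ) (c j) * (zpowSum (n - (j : ℕ)) z * (linForm c z : ℂ) ^ (m - 1))))
      ∂(gasLaw N M h) = 0 := by
    rw [integral_discreteGas, mul_eq_zero]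
    right
    rw [← h1]
    refine Finset.sum_congr rfl fun z _ => ?_
    have h4 : ∑ j : Fin l, ((j : ℂ) + 1) *
        (c j * (powerSum (n + 1 + (j + 1)) z * (linForm c z : ℂ) ^ (m - 1)) -
          (starRingEnd ℂ) (c j) * (zpowSum (n - (j : ℕ)) z * (linForm c z : ℂ) ^ (m - 1))) =
        (∑ j : Fin l, ((j : ℂ) + 1) * (c j * powerSum (n + 1 + (j + 1)) z -
          (starRingEnd ℂ) (c j) * zpowSum (n - (j : ℕ)) z)) * (linForm c z : ℂ) ^ (m - 1) := by
      rw [Finset.sum_mul]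
      exact Finset.sum_congr rfl fun j _ => by ring
    rw [h2, h4, ← Finset.sum_mul]
    ring
  rw [integral_add (integrable_discreteGas h _) (integrable_discreteGas h _),
    integral_add (integrable_discreteGas h _) (integrable_discreteGas h _),
    integral_const_mul, integral_const_mul,
    integral_finsetSum _ fun _ _ => integrable_discreteGas h _,
    integral_finsetSum _ fun _ _ => integrable_discreteGas h _] at h3
  simp_rw [integral_const_mul, integral_sub (integrable_discreteGas h _)
    (integrable_discreteGas h _), integral_const_mul] at h3
  rw [eq_neg_add_iff_add_eq, ← sub_eq_zero, ← h3]
  rw [add_comm (∑ a ∈ Finset.range n, _), sub_eq_add_neg]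
  congr 1
  rw [← mul_neg, ← Finset.sum_neg_distrib]
  congr 1
  exact Finset.sum_congr rfl fun j _ => by ring

end moments
end LogGas

namespace LogGas

/-! ### Uniform moment bounds. -/

section bounds

theorem mul_pow_le_young {x y K : ℝ} (hx : 0 ≤ x) (hy : 0 ≤ y) (hK : 0 < K) (q : ℕ) :
    y * x ^ q ≤ x ^ (q + 1) / K + K ^ q * y ^ (q + 1) := by
  rcases le_total (K * y) x with h | h
  · have h1 : y * x ^ q ≤ x ^ (q + 1) / K := by
      rw [le_div_iff₀ hK, pow_succ']
      nlinarith [mul_le_mul_of_nonneg_right h (pow_nonneg hx q)]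
    have : 0 ≤ K ^ q * y ^ (q + 1) := by positivity
    linarith
  · have h1 : y * x ^ q ≤ K ^ q * y ^ (q + 1) := by
      calc y * x ^ q ≤ y * (K * y) ^ q := by gcongr
        _ = _ := by ring
    have : 0 ≤ x ^ (q + 1) / K := by positivity
    linarith

theorem linForm_single {N M k : ℕ} (γ : ℂ) (z : Fin N → discreteCircle M) :
    linForm (Pi.single (Fin.last k) γ) z = 2 * (γ * powerSum (k + 1) z).re := by
  rw [linForm, Finset.sum_eq_single (Fin.last k)]
  · simp
  · intro j _ hj
    simp [hj]
  · simp

variable {N M : ℕ}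

/-- In each term on the right of the loop equation one power sum is bounded trivially by `N`,
cancelling the `N` on the left. In the quadratic terms the surviving factor has index `a + 1 ≤ k`,
ready for induction on `k`. -/
theorem norm_integral_loop_single {k m : ℕ} (h : N ≤ M) (hN : 1 ≤ N) {γ : ℂ} (hγ : ‖γ‖ ≤ 1)
    (hm : k + 1 + (m + 1) * (k + 1) + N ≤ M) :
    ‖∫ z, powerSum (k + 1) z * (linForm (Pi.single (Fin.last k) γ) z : ℂ) ^ (m + 1)
      ∂(gasLaw N M h)‖ ≤
      (∑ a ∈ Finset.range k, ∫ z, ‖powerSum (a + 1) z‖ *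
        |linForm (Pi.single (Fin.last k) γ) z| ^ (m + 1) ∂(gasLaw N M h)) +
      2 * (m + 1) * (k + 1) *
        ∫ z, |linForm (Pi.single (Fin.last k) γ) z| ^ m ∂(gasLaw N M h) := by
  set X : (Fin N → discreteCircle M) → ℝ := linForm (Pi.single (Fin.last k) γ) with hX
  have hN' : (0 : ℝ) < N := by exact_mod_cast hN
  have hl := integral_loop h hm (Pi.single (Fin.last k) γ)
  rw [Finset.sum_eq_single (Fin.last k) (by intro j _ hj; simp [hj]) (by simp)] at hl
  simp only [Pi.single_eq_same, ← hX, Nat.add_sub_cancel] at hl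
  have hb : ∀ (f : (Fin N → discreteCircle M) → ℂ), (∀ z, ‖f z‖ ≤ N) →
      ∀ (g : (Fin N → discreteCircle M) → ℂ),
      ‖∫ z, f z * g z ∂(gasLaw N M h)‖ ≤ N * ∫ z, ‖g z‖ ∂(gasLaw N M h) := by
    intro f hf g
    refine (norm_integral_le_integral_norm _).trans ?_
    rw [← integral_const_mul]
    refine integral_mono (integrable_discreteGas h _) (integrable_discreteGas h _) fun z => ?_
    simp only [norm_mul]
    exact mul_le_mul_of_nonneg_right (hf z) (norm_nonneg _)
  refine le_of_mul_le_mul_left ?_ hN'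
  calc (N : ℝ) * ‖∫ z, powerSum (k + 1) z * (X z : ℂ) ^ (m + 1) ∂(gasLaw N M h)‖
      = ‖(N : ℂ) * ∫ z, powerSum (k + 1) z * (X z : ℂ) ^ (m + 1) ∂(gasLaw N M h)‖ := by simp
    _ ≤ _ := by
      rw [hl]
      refine (norm_add_le _ _).trans ?_
      rw [mul_add]
      refine add_le_add ?_ ?_
      · rw [norm_neg, Finset.mul_sum]
        refine (norm_sum_le _ _).trans (Finset.sum_le_sum fun a _ => ?_)
        have := hb (fun z => powerSum (k - a) z) (fun z => norm_powerSum_le _ z)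
          (fun z => powerSum (a + 1) z * (X z : ℂ) ^ (m + 1))
        simp only [norm_mul, norm_pow, Complex.norm_real, Real.norm_eq_abs] at this
        refine le_trans (le_of_eq ?_) this
        congr 2
        ext z
        ring
      · have h1 := hb (fun z => zpowSum (k - ((Fin.last k : Fin (k + 1)) : ℕ)) z)
          (fun z => norm_zpowSum_le _ z) (fun z => (X z : ℂ) ^ m)
        have h2 := hb (fun z => powerSum (k + 1 + (((Fin.last k : Fin (k + 1)) : ℕ) + 1)) z)
          (fun z => norm_powerSum_le _ z) (fun z => (X z : ℂ) ^ m)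
        simp only [norm_pow, Complex.norm_real, Real.norm_eq_abs] at h1 h2
        set E := ∫ z, |X z| ^ m ∂(gasLaw N M h)
        have hE : 0 ≤ E := integral_nonneg fun z => by positivity
        set A := ∫ z, zpowSum (k - ((Fin.last k : Fin (k + 1)) : ℕ)) z * (X z : ℂ) ^ m
          ∂(gasLaw N M h)
        set B := ∫ z, powerSum (k + 1 + (((Fin.last k : Fin (k + 1)) : ℕ) + 1)) z * (X z : ℂ) ^ m
          ∂(gasLaw N M h)
        have h3 : ‖(starRingEnd ℂ) γ * A - γ * B‖ ≤ 2 * (N * E) := by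
          refine (norm_sub_le _ _).trans ?_
          rw [norm_mul, norm_mul, Complex.norm_conj]
          have := mul_le_mul hγ h1 (norm_nonneg _) zero_le_one
          have := mul_le_mul hγ h2 (norm_nonneg _) zero_le_one
          linarith
        have e1 : ‖(((m + 1 : ℕ) : ℂ))‖ = m + 1 := by
          rw [Complex.norm_natCast]
          push_cast
          rfl
        have e2 : ‖((((Fin.last k : Fin (k + 1)) : ℕ) : ℂ) + 1)‖ = k + 1 := by
          rw [Fin.val_last]
          exact_mod_cast Complex.norm_natCast (k + 1)
        rw [norm_mul, norm_mul, e1, e2]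
        calc ((m : ℝ) + 1) * ((k + 1) * ‖(starRingEnd ℂ) γ * A - γ * B‖)
            ≤ (m + 1) * ((k + 1) * (2 * (N * E))) := by gcongr
          _ = _ := by ring

theorem integral_linForm_single_pow_le {k : ℕ}
    (hk : ∀ a < k, ∀ m : ℕ, ∃ (C : ℝ) (D : ℕ), ∀ (N M : ℕ) (h : N ≤ M), 1 ≤ N → N + D ≤ M →
      ∫ z, ‖powerSum (a + 1) z‖ ^ (2 * m) ∂(gasLaw N M h) ≤ C)
    {γ : ℂ} (hγ : ‖γ‖ ≤ 1) (m : ℕ) :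
    ∃ (C : ℝ) (D : ℕ), ∀ (N M : ℕ) (h : N ≤ M), 1 ≤ N → N + D ≤ M →
      ∫ z, |linForm (Pi.single (Fin.last k) γ) z| ^ (2 * m) ∂(gasLaw N M h) ≤ C := by
  induction m with
  | zero =>
    refine ⟨1, 0, fun N M h _ _ => ?_⟩
    simp
  | succ m ih =>
    obtain ⟨C, D, hC⟩ := ih
    choose! Ca Da hCa using fun a ha => hk a ha (m + 1)
    -- In `S ≤ 2 (k S / K + …)` this choice makes the `S` term at most `S / 2`, to be absorbed on
    -- the left.
    set K : ℝ := 4 * (k + 1) with hK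
    have hK0 : 0 < K := by positivity
    refine ⟨2 * (∑ a ∈ Finset.range k, 2 * (K ^ (2 * m + 1) * Ca a) +
      4 * (2 * m + 1) * (k + 1) * C), D + ∑ a ∈ Finset.range k, Da a +
        (k + 1 + (2 * m + 1) * (k + 1)), fun N M h hN hD => ?_⟩
    have hl := norm_integral_loop_single (m := 2 * m) h hN hγ (k := k) (by omega)
    specialize hC N M h hN (by omega)
    set X : (Fin N → discreteCircle M) → ℝ := linForm (Pi.single (Fin.last k) γ) with hX
    set S := ∫ z, |X z| ^ (2 * (m + 1)) ∂(gasLaw N M h) with hS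
    have hS0 : 0 ≤ S := integral_nonneg fun z => by positivity
    have h1 : S = 2 * (γ * ∫ z, powerSum (k + 1) z * (X z : ℂ) ^ (2 * m + 1) ∂(gasLaw N M h)).re := by
      rw [← integral_const_mul, ← RCLike.re_eq_complex_re, ← integral_re (integrable_discreteGas h _),
        ← integral_const_mul, hS]
      congr 1
      ext z
      rw [RCLike.re_eq_complex_re, ← mul_assoc, ← Complex.ofReal_pow, Complex.re_mul_ofReal, ← mul_assoc,
        ← linForm_single, ← hX, (even_two_mul (m + 1)).pow_abs]
      ring
    have h2 : S ≤ 2 * ‖∫ z, powerSum (k + 1) z * (X z : ℂ) ^ (2 * m + 1) ∂(gasLaw N M h)‖ := by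
      rw [h1]
      have := (Complex.re_le_norm (γ * ∫ z, powerSum (k + 1) z * (X z : ℂ) ^ (2 * m + 1)
        ∂(gasLaw N M h)))
      rw [norm_mul] at this
      nlinarith [norm_nonneg (∫ z, powerSum (k + 1) z * (X z : ℂ) ^ (2 * m + 1) ∂(gasLaw N M h))]
    have h3 : ∀ a ∈ Finset.range k, ∫ z, ‖powerSum (a + 1) z‖ * |X z| ^ (2 * m + 1) ∂(gasLaw N M h) ≤
        S / K + K ^ (2 * m + 1) * Ca a := by
      intro a ha
      have hDa : Da a ≤ ∑ a ∈ Finset.range k, Da a :=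
        Finset.single_le_sum (f := Da) (fun _ _ => Nat.zero_le _) ha
      have h4 := hCa a (Finset.mem_range.1 ha) N M h hN (by omega)
      calc ∫ z, ‖powerSum (a + 1) z‖ * |X z| ^ (2 * m + 1) ∂(gasLaw N M h)
          ≤ ∫ z, (|X z| ^ (2 * (m + 1)) / K + K ^ (2 * m + 1) *
            ‖powerSum (a + 1) z‖ ^ (2 * (m + 1))) ∂(gasLaw N M h) :=
            integral_mono (integrable_discreteGas h _) (integrable_discreteGas h _) fun z =>
              mul_pow_le_young (abs_nonneg _) (norm_nonneg _) hK0 _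
        _ = S / K + K ^ (2 * m + 1) * ∫ z, ‖powerSum (a + 1) z‖ ^ (2 * (m + 1)) ∂(gasLaw N M h) := by
          rw [integral_add (integrable_discreteGas h _) (integrable_discreteGas h _),
            integral_div, integral_const_mul]
        _ ≤ _ := by gcongr
    have h5 := Finset.sum_le_sum h3
    rw [Finset.sum_add_distrib, Finset.sum_const, Finset.card_range, nsmul_eq_mul] at h5
    have h6 : k * (S / K) ≤ S / 4 := by
      rw [hK, mul_div_assoc', div_le_div_iff₀ (by positivity) (by norm_num)]
      nlinarith
    have h7 : 2 * (2 * m + 1) * (k + 1) * ∫ z, |X z| ^ (2 * m) ∂(gasLaw N M h) ≤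
      2 * (2 * m + 1) * (k + 1) * C := by gcongr
    push_cast at hl
    rw [← Finset.mul_sum]
    linarith

/-- The even moments of each power sum are bounded, uniformly in `N` and in `M - N` large. -/
theorem integral_norm_powerSum_pow_le (k m : ℕ) :
    ∃ (C : ℝ) (D : ℕ), ∀ (N M : ℕ) (h : N ≤ M), 1 ≤ N → N + D ≤ M →
      ∫ z, ‖powerSum (k + 1) z‖ ^ (2 * m) ∂(gasLaw N M h) ≤ C := by
  induction k using Nat.strong_induction_on generalizing m with
  | _ k ih =>
    -- The values `1/2` and `-I/2` of `γ` turn the linear form into the real and imaginary parts of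
    -- the power sum.
    obtain ⟨C₁, D₁, h₁⟩ := integral_linForm_single_pow_le ih (γ := 1 / 2) (by norm_num) m
    obtain ⟨C₂, D₂, h₂⟩ := integral_linForm_single_pow_le ih (γ := -Complex.I / 2) (by norm_num) m
    refine ⟨2 ^ (m - 1) * (C₁ + C₂), D₁ + D₂, fun N M h hN hD => ?_⟩
    specialize h₁ N M h hN (by omega)
    specialize h₂ N M h hN (by omega)
    calc ∫ z, ‖powerSum (k + 1) z‖ ^ (2 * m) ∂(gasLaw N M h)
        ≤ ∫ z, 2 ^ (m - 1) * (|linForm (Pi.single (Fin.last k) (1 / 2)) z| ^ (2 * m) +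
          |linForm (Pi.single (Fin.last k) (-Complex.I / 2)) z| ^ (2 * m)) ∂(gasLaw N M h) := by
          refine integral_mono (integrable_discreteGas h _) (integrable_discreteGas h _) fun z => ?_
          simp only [pow_mul, sq_abs, linForm_single]
          refine le_trans (le_of_eq ?_) (add_pow_le (sq_nonneg _) (sq_nonneg _) m)
          rw [← Complex.normSq_eq_norm_sq, Complex.normSq_apply]
          congr 1
          simp
          ring
      _ ≤ _ := by
        rw [integral_const_mul, integral_add (integrable_discreteGas h _)
          (integrable_discreteGas h _)]
        gcongr

end bounds
end LogGas

namespace LogGas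

/-! ### Asymptotic Gaussian recursion for the moments. -/

section sequences

variable {N M : ℕ → ℕ} {h : ∀ n, N n ≤ M n}

/-- All absolute moments of the observables `f n` under `ℙ_{N_n, M_n}` are eventually bounded. -/
def MomentBdd (h : ∀ n, N n ≤ M n) (f : ∀ n, (Fin (N n) → discreteCircle (M n)) → ℂ) : Prop :=
  ∀ r : ℕ, ∃ C : ℝ, ∀ᶠ n in atTop, ∫ z, ‖f n z‖ ^ r ∂(gasLaw (N n) (M n) (h n)) ≤ C

namespace MomentBdd

variable {f g : ∀ n, (Fin (N n) → discreteCircle (M n)) → ℂ}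

theorem mono (hf : MomentBdd h f) (hfg : ∀ n z, ‖g n z‖ ≤ ‖f n z‖) : MomentBdd h g := by
  intro r
  obtain ⟨C, hC⟩ := hf r
  refine ⟨C, hC.mono fun n hn => le_trans ?_ hn⟩
  refine integral_mono (integrable_discreteGas _ _) (integrable_discreteGas _ _) fun z => ?_
  exact pow_le_pow_left₀ (norm_nonneg _) (hfg n z) r

theorem const (a : ℂ) : MomentBdd h fun _ _ => a := by
  intro r
  refine ⟨‖a‖ ^ r, Eventually.of_forall fun n => ?_⟩
  simp

theorem mul (hf : MomentBdd h f) (hg : MomentBdd h g) :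
    MomentBdd h fun n z => f n z * g n z := by
  intro r
  obtain ⟨C, hC⟩ := hf (2 * r)
  obtain ⟨D, hD⟩ := hg (2 * r)
  refine ⟨C + D, (hC.and hD).mono fun n hn => ?_⟩
  refine le_trans ?_ (add_le_add hn.1 hn.2)
  rw [← integral_add (integrable_discreteGas _ _) (integrable_discreteGas _ _)]
  refine integral_mono (integrable_discreteGas _ _) (integrable_discreteGas _ _) fun z => ?_
  simp only [norm_mul, mul_pow]
  rw [mul_comm 2 r, pow_mul, pow_mul]
  nlinarith [sq_nonneg (‖f n z‖ ^ r - ‖g n z‖ ^ r), sq_nonneg (‖f n z‖ ^ r),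
    sq_nonneg (‖g n z‖ ^ r)]

theorem add (hf : MomentBdd h f) (hg : MomentBdd h g) :
    MomentBdd h fun n z => f n z + g n z := by
  intro r
  obtain ⟨C, hC⟩ := hf r
  obtain ⟨D, hD⟩ := hg r
  refine ⟨2 ^ (r - 1) * (C + D), (hC.and hD).mono fun n hn => ?_⟩
  refine le_trans ?_ (mul_le_mul_of_nonneg_left (add_le_add hn.1 hn.2) (by positivity))
  rw [← integral_add (integrable_discreteGas _ _) (integrable_discreteGas _ _),
    ← integral_const_mul]
  refine integral_mono (integrable_discreteGas _ _) (integrable_discreteGas _ _) fun z => ?_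
  exact (pow_le_pow_left₀ (norm_nonneg _) (norm_add_le _ _) r).trans
    (add_pow_le (norm_nonneg _) (norm_nonneg _) r)

theorem sum {ι : Type*} (s : Finset ι) {f : ι → ∀ n, (Fin (N n) → discreteCircle (M n)) → ℂ}
    (hf : ∀ i ∈ s, MomentBdd h (f i)) : MomentBdd h fun n z => ∑ i ∈ s, f i n z := by
  classical
  induction s using Finset.induction_on with
  | empty => simpa using MomentBdd.const 0
  | insert a s ha ih =>
    simp_rw [Finset.sum_insert ha]
    exact (hf a (by simp)).add (ih fun i hi => hf i (by simp [hi]))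

theorem pow (hf : MomentBdd h f) (m : ℕ) : MomentBdd h fun n z => f n z ^ m := by
  induction m with
  | zero => simpa using MomentBdd.const 1
  | succ m ih =>
    simp_rw [pow_succ]
    exact ih.mul hf

theorem tendsto_integral_div (hf : MomentBdd h f) (hN : Tendsto N atTop atTop) :
    Tendsto (fun n => (∫ z, f n z ∂(gasLaw (N n) (M n) (h n))) / (N n : ℂ)) atTop (nhds 0) := by
  obtain ⟨C, hC⟩ := hf 1
  have h1 : Tendsto (fun n => C / (N n : ℝ)) atTop (nhds 0) :=
    (tendsto_const_div_atTop_nhds_zero_nat C).comp hN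
  refine squeeze_zero_norm' (hC.mono fun n hn => ?_) h1
  rw [norm_div, Complex.norm_natCast]
  refine div_le_div_of_nonneg_right ?_ (Nat.cast_nonneg _)
  refine (norm_integral_le_integral_norm _).trans ?_
  simpa using hn

end MomentBdd

theorem eventually_add_le (h : ∀ n, N n ≤ M n)
    (hMN : Tendsto (fun n => M n - N n) atTop atTop) (D : ℕ) :
    ∀ᶠ n in atTop, N n + D ≤ M n := by
  filter_upwards [hMN.eventually_ge_atTop D] with n hn
  have := h n
  omega

theorem momentBdd_powerSum (hNpos : ∀ n, 1 ≤ N n)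
    (hMN : Tendsto (fun n => M n - N n) atTop atTop) (k : ℕ) :
    MomentBdd h fun _ z => powerSum (k + 1) z := by
  intro r
  obtain ⟨C, D, hC⟩ := integral_norm_powerSum_pow_le k r
  refine ⟨1 + C, (eventually_add_le h hMN D).mono fun n hn => ?_⟩
  have h1 := hC _ _ (h n) (hNpos n) hn
  calc ∫ z, ‖powerSum (k + 1) z‖ ^ r ∂(gasLaw (N n) (M n) (h n))
      ≤ ∫ z, (1 + ‖powerSum (k + 1) z‖ ^ (2 * r)) ∂(gasLaw (N n) (M n) (h n)) := by
        refine integral_mono (integrable_discreteGas _ _) (integrable_discreteGas _ _)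
          fun z => ?_
        simp only
        rw [mul_comm, pow_mul]
        nlinarith [sq_nonneg (‖powerSum (k + 1) z‖ ^ r - 1)]
    _ ≤ _ := by
      rw [integral_add (integrable_discreteGas _ _) (integrable_discreteGas _ _)]
      simpa using h1

theorem momentBdd_zpowSum (hNpos : ∀ n, 1 ≤ N n)
    (hMN : Tendsto (fun n => M n - N n) atTop atTop) {k : ℤ} (hk : k ≠ 0) :
    MomentBdd h fun _ z => zpowSum k z := by
  obtain ⟨m, hm⟩ := Nat.exists_eq_succ_of_ne_zero (Int.natAbs_ne_zero.2 hk)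
  refine (momentBdd_powerSum hNpos hMN m).mono fun n z => ?_
  rw [norm_zpowSum_eq, hm]

theorem momentBdd_linForm (hNpos : ∀ n, 1 ≤ N n)
    (hMN : Tendsto (fun n => M n - N n) atTop atTop) {l : ℕ} (c : Fin l → ℂ) :
    MomentBdd h fun _ z => (linForm c z : ℂ) := by
  simp_rw [ofReal_linForm]
  exact MomentBdd.sum _ fun j _ =>
    ((MomentBdd.const _).mul (momentBdd_zpowSum hNpos hMN (by omega))).add
      ((MomentBdd.const _).mul (momentBdd_zpowSum hNpos hMN (by omega)))

/-- After division by `N`, every term with bounded moments disappears; only `j = k`, where the power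
sum is exactly `N`, survives. For `m = 0` the truncated exponent `m - 1` is harmless, being
multiplied by `m`. -/
theorem tendsto_integral_powerSum_mul (hNpos : ∀ n, 1 ≤ N n) (hN : Tendsto N atTop atTop)
    (hMN : Tendsto (fun n => M n - N n) atTop atTop) {l : ℕ} (c : Fin l → ℂ) (k : Fin l)
    (m : ℕ) :
    Tendsto (fun n => (∫ z, powerSum (k + 1) z * (linForm c z : ℂ) ^ m
        ∂(gasLaw (N n) (M n) (h n))) - m * ((k : ℂ) + 1) * (starRingEnd ℂ) (c k) *
        ∫ z, (linForm c z : ℂ) ^ (m - 1) ∂(gasLaw (N n) (M n) (h n))) atTop (nhds 0) := by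
  have hX := momentBdd_linForm (h := h) hNpos hMN c
  have hT : ∀ a ∈ Finset.range (k : ℕ), Tendsto (fun n => (∫ z, powerSum (a + 1) z *
      powerSum (k - a) z * (linForm c z : ℂ) ^ m ∂(gasLaw (N n) (M n) (h n))) / (N n : ℂ))
      atTop (nhds 0) := by
    intro a ha
    obtain ⟨b, hb⟩ := Nat.exists_eq_succ_of_ne_zero
      (Nat.sub_ne_zero_of_lt (Finset.mem_range.1 ha))
    rw [hb]
    exact (((momentBdd_powerSum hNpos hMN a).mul (momentBdd_powerSum hNpos hMN b)).mul
      (hX.pow m)).tendsto_integral_div hN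
  have hU : ∀ j : Fin l, Tendsto (fun n => (∫ z, zpowSum ((k : ℕ) - (j : ℕ)) z *
      (linForm c z : ℂ) ^ (m - 1) ∂(gasLaw (N n) (M n) (h n))) / (N n : ℂ) -
      if j = k then ∫ z, (linForm c z : ℂ) ^ (m - 1) ∂(gasLaw (N n) (M n) (h n)) else 0)
      atTop (nhds 0) := by
    intro j
    by_cases hj : j = k
    · subst hj
      refine tendsto_const_nhds.congr fun n => ?_
      have : (N n : ℂ) ≠ 0 := by exact_mod_cast (Nat.one_le_iff_ne_zero.1 (hNpos n))
      simp only [sub_self, zpowSum_zero, if_true]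
      rw [integral_const_mul, mul_div_cancel_left₀ _ this, sub_self]
    · simp only [if_neg hj, sub_zero]
      refine ((momentBdd_zpowSum hNpos hMN ?_).mul (hX.pow (m - 1))).tendsto_integral_div hN
      intro h0
      exact hj (Fin.ext (by omega))
  have hV : ∀ j : Fin l, Tendsto (fun n => (∫ z, powerSum (k + 1 + (j + 1)) z *
      (linForm c z : ℂ) ^ (m - 1) ∂(gasLaw (N n) (M n) (h n))) / (N n : ℂ))
      atTop (nhds 0) := fun j =>
    ((momentBdd_powerSum hNpos hMN (k + 1 + j)).mul (hX.pow (m - 1))).tendsto_integral_div hN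
  have key := ((tendsto_finsetSum _ hT).neg).add ((tendsto_finsetSum Finset.univ fun j _ =>
    (((hU j).const_mul ((starRingEnd ℂ) (c j))).sub ((hV j).const_mul (c j))).const_mul
      ((j : ℂ) + 1)).const_mul (m : ℂ))
  simp only [mul_zero, sub_zero, Finset.sum_const_zero, neg_zero, add_zero] at key
  refine key.congr' ?_
  filter_upwards [eventually_add_le h hMN (k + 1 + m * l)] with n hn
  have hN0 : (N n : ℂ) ≠ 0 := by exact_mod_cast (Nat.one_le_iff_ne_zero.1 (hNpos n))
  have hl := integral_loop (h n) (n := k) (m := m) (by omega) c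
  rw [mul_comm (N n : ℂ), ← eq_div_iff hN0] at hl
  rw [hl, add_div, neg_div, Finset.sum_div, mul_div_assoc, Finset.sum_div, add_sub_assoc]
  congr 1
  have hs : ((k : ℂ) + 1) * (starRingEnd ℂ) (c k) *
      ∫ z, (linForm c z : ℂ) ^ (m - 1) ∂(gasLaw (N n) (M n) (h n)) =
      ∑ j : Fin l, ((j : ℂ) + 1) * (starRingEnd ℂ) (c j) * if j = k then
        ∫ z, (linForm c z : ℂ) ^ (m - 1) ∂(gasLaw (N n) (M n) (h n)) else 0 := by
    simp
  rw [mul_assoc (m : ℂ), mul_assoc (m : ℂ), hs, ← mul_sub, ← Finset.sum_sub_distrib]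
  congr 1
  refine Finset.sum_congr rfl fun j _ => ?_
  ring

/-- The variance of the Gaussian limit of `linForm c`. -/
noncomputable def linFormVariance {l : ℕ} (c : Fin l → ℂ) : ℝ :=
  2 * ∑ k : Fin l, ((k : ℝ) + 1) * ‖c k‖ ^ 2

theorem re_integral_discreteGas {N M : ℕ} (h : N ≤ M)
    (f : (Fin N → discreteCircle M) → ℂ) :
    (∫ z, f z ∂(gasLaw N M h)).re = ∫ z, (f z).re ∂(gasLaw N M h) :=
  (integral_re (𝕜 := ℂ) (integrable_discreteGas h f)).symm

/-- Pairing the previous limit with `c k` and taking twice the real part reassembles one factor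
`linForm c`; this is Stein's identity for monomials. -/
theorem tendsto_integral_linForm_pow_sub (hNpos : ∀ n, 1 ≤ N n) (hN : Tendsto N atTop atTop)
    (hMN : Tendsto (fun n => M n - N n) atTop atTop) {l : ℕ} (c : Fin l → ℂ) (m : ℕ) :
    Tendsto (fun n => (∫ z, linForm c z ^ (m + 1) ∂(gasLaw (N n) (M n) (h n))) -
      m * linFormVariance c * ∫ z, linForm c z ^ (m - 1) ∂(gasLaw (N n) (M n) (h n)))
      atTop (nhds 0) := by
  have h1 := tendsto_finsetSum Finset.univ fun (k : Fin l) _ =>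
    (tendsto_integral_powerSum_mul (h := h) hNpos hN hMN c k m).const_mul (c k)
  have h2 := ((Complex.continuous_re.tendsto _).comp h1).const_mul 2
  simp only [mul_zero, Finset.sum_const_zero, Complex.zero_re] at h2
  refine h2.congr fun n => ?_
  have h3 : ∫ z, linForm c z ^ (m + 1) ∂(gasLaw (N n) (M n) (h n)) = 2 * ∑ k : Fin l,
      (c k * ∫ z, powerSum (k + 1) z * (linForm c z : ℂ) ^ m
        ∂(gasLaw (N n) (M n) (h n))).re := by
    simp_rw [← integral_const_mul, re_integral_discreteGas]
    rw [← integral_finsetSum _ fun _ _ => integrable_discreteGas _ _, ← integral_const_mul]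
    congr 1
    ext z
    rw [pow_succ']
    nth_rw 1 [linForm]
    rw [Finset.sum_mul, Finset.mul_sum]
    refine Finset.sum_congr rfl fun k _ => ?_
    rw [← mul_assoc (c k), ← Complex.ofReal_pow, Complex.re_mul_ofReal]
    ring
  have h4 : ∫ z, (linForm c z : ℂ) ^ (m - 1) ∂(gasLaw (N n) (M n) (h n)) =
      ((∫ z, linForm c z ^ (m - 1) ∂(gasLaw (N n) (M n) (h n)) : ℝ) : ℂ) := by
    rw [← integral_complex_ofReal]
    simp
  rw [h3, Function.comp_apply, h4, Complex.re_sum, linFormVariance]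
  simp only [mul_sub, Complex.sub_re, Finset.sum_sub_distrib]
  congr 1
  rw [Finset.mul_sum, Finset.mul_sum, Finset.mul_sum, Finset.sum_mul]
  refine Finset.sum_congr rfl fun k _ => ?_
  have : c k * (m * ((k : ℂ) + 1) * (starRingEnd ℂ) (c k) *
      ((∫ z, linForm c z ^ (m - 1) ∂(gasLaw (N n) (M n) (h n)) : ℝ) : ℂ)) =
      ((m * ((k : ℝ) + 1) * ‖c k‖ ^ 2 *
        ∫ z, linForm c z ^ (m - 1) ∂(gasLaw (N n) (M n) (h n)) : ℝ) : ℂ) := by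
    have := Complex.mul_conj' (c k)
    push_cast
    rw [← this]
    ring
  rw [this, Complex.ofReal_re]
  ring

/-- The moments of a linear form in the power sums converge to those of a centered Gaussian. -/
theorem tendsto_integral_linForm_pow (hNpos : ∀ n, 1 ≤ N n) (hN : Tendsto N atTop atTop)
    (hMN : Tendsto (fun n => M n - N n) atTop atTop) {l : ℕ} (c : Fin l → ℂ) (q : ℕ) :
    Tendsto (fun n => ∫ z, linForm c z ^ (2 * q) ∂(gasLaw (N n) (M n) (h n))) atTop
        (nhds ((2 * q).factorial * ((linFormVariance c / 2) ^ q / q.factorial))) ∧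
      Tendsto (fun n => ∫ z, linForm c z ^ (2 * q + 1) ∂(gasLaw (N n) (M n) (h n))) atTop
        (nhds 0) := by
  have step : ∀ (m : ℕ) (L : ℝ),
      Tendsto (fun n => ∫ z, linForm c z ^ m ∂(gasLaw (N n) (M n) (h n))) atTop (nhds L) →
      Tendsto (fun n => ∫ z, linForm c z ^ (m + 2) ∂(gasLaw (N n) (M n) (h n))) atTop
        (nhds ((m + 1) * linFormVariance c * L)) := by
    intro m L hL
    have h1 := (tendsto_integral_linForm_pow_sub (h := h) hNpos hN hMN c (m + 1)).add
      (hL.const_mul ((m + 1) * linFormVariance c))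
    rw [zero_add] at h1
    refine h1.congr fun n => ?_
    push_cast
    simp
  induction q with
  | zero =>
    refine ⟨by simp, ?_⟩
    -- At `m = 0` the recursion says that the mean tends to `0`.
    have := tendsto_integral_linForm_pow_sub (h := h) hNpos hN hMN c 0
    simpa using this
  | succ q ih =>
    refine ⟨?_, ?_⟩
    · have e : ((2 * (q + 1)).factorial : ℝ) *
          ((linFormVariance c / 2) ^ (q + 1) / ((q + 1).factorial : ℝ)) =
          (((2 * q : ℕ) : ℝ) + 1) * linFormVariance c *
            ((2 * q).factorial * ((linFormVariance c / 2) ^ q / q.factorial)) := by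
        rw [mul_add_one, Nat.factorial_succ, Nat.factorial_succ, Nat.factorial_succ]
        have := (Nat.cast_ne_zero (R := ℝ)).2 q.factorial_ne_zero
        push_cast
        field_simp
        ring
      rw [e]
      exact step _ _ ih.1
    · have e : 2 * (q + 1) + 1 = 2 * q + 1 + 2 := by ring
      rw [e]
      simpa using step _ _ ih.2

end sequences
end LogGas

namespace LogGas

/-! ### From moments to characteristic functions. -/

section charFun

theorem hasDerivAt_exp_I_mul_sub_sum (n : ℕ) (x : ℝ) :
    HasDerivAt (fun x : ℝ => Complex.exp (Complex.I * x) -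
        ∑ m ∈ Finset.range (n + 1), (Complex.I * x) ^ m / (m.factorial : ℂ))
      (Complex.I * (Complex.exp (Complex.I * x) -
        ∑ m ∈ Finset.range n, (Complex.I * x) ^ m / (m.factorial : ℂ))) x := by
  have hI : HasDerivAt (fun x : ℝ => Complex.I * (x : ℂ)) Complex.I x := by
    simpa using (Complex.ofRealCLM.hasDerivAt (x := x)).const_mul Complex.I
  have h1 := hI.cexp
  have h2 : HasDerivAt (fun x : ℝ => ∑ m ∈ Finset.range (n + 1),
      (Complex.I * x) ^ m / (m.factorial : ℂ))
      (∑ m ∈ Finset.range n, Complex.I * ((Complex.I * x) ^ m / (m.factorial : ℂ))) x := by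
    simp_rw [Finset.sum_range_succ' _ n]
    simp only [pow_zero]
    refine HasDerivAt.add_const _ (HasDerivAt.fun_sum fun m _ => ?_)
    refine ((hI.fun_pow (m + 1)).div_const ((m + 1).factorial : ℂ)).congr_deriv ?_
    have : (m.factorial : ℂ) ≠ 0 := Nat.cast_ne_zero.2 m.factorial_ne_zero
    have : (m : ℂ) + 1 ≠ 0 := Nat.cast_add_one_ne_zero m
    rw [Nat.factorial_succ]
    push_cast
    field_simp
  refine (h1.sub h2).congr_deriv ?_
  rw [← Finset.mul_sum]
  ring

/-- Up to the unimodular factor `I`, each Taylor remainder has the preceding one as derivative, so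
the bound integrates up inductively. -/
theorem norm_exp_I_mul_sub_sum_le_of_nonneg (n : ℕ) :
    ∀ x : ℝ, 0 ≤ x → ‖Complex.exp (Complex.I * x) -
      ∑ m ∈ Finset.range n, (Complex.I * x) ^ m / (m.factorial : ℂ)‖ ≤ x ^ n / n.factorial := by
  induction n with
  | zero =>
    intro x _
    simp [Complex.norm_exp]
  | succ n ih =>
    intro x hx
    refine image_norm_le_of_norm_deriv_right_le_deriv_boundary (a := 0) (b := x)
      (f := fun x : ℝ => Complex.exp (Complex.I * x) -
        ∑ m ∈ Finset.range (n + 1), (Complex.I * x) ^ m / (m.factorial : ℂ))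
      (B := fun x => x ^ (n + 1) / (n + 1).factorial) (B' := fun x => x ^ n / n.factorial)
      (fun y _ => (hasDerivAt_exp_I_mul_sub_sum n y).continuousAt.continuousWithinAt)
      (fun y _ => (hasDerivAt_exp_I_mul_sub_sum n y).hasDerivWithinAt) ?_ ?_ ?_ ⟨hx, le_rfl⟩
    · simp [Finset.sum_range_succ']
    · intro y
      refine (((hasDerivAt_id y).fun_pow (n + 1)).div_const ((n + 1).factorial : ℝ)).congr_deriv ?_
      have : (n.factorial : ℝ) ≠ 0 := Nat.cast_ne_zero.2 n.factorial_ne_zero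
      have : (n : ℝ) + 1 ≠ 0 := Nat.cast_add_one_ne_zero n
      rw [Nat.factorial_succ]
      push_cast
      simp only [id]
      field_simp
    · intro y hy
      rw [norm_mul, Complex.norm_I, one_mul]
      exact ih y hy.1

theorem norm_exp_I_mul_sub_sum_le (n : ℕ) (x : ℝ) :
    ‖Complex.exp (Complex.I * x) -
      ∑ m ∈ Finset.range n, (Complex.I * x) ^ m / (m.factorial : ℂ)‖ ≤
        |x| ^ n / n.factorial := by
  rcases le_total 0 x with hx | hx
  · rw [abs_of_nonneg hx]
    exact norm_exp_I_mul_sub_sum_le_of_nonneg n x hx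
  · rw [abs_of_nonpos hx]
    refine le_trans (le_of_eq ?_) (norm_exp_I_mul_sub_sum_le_of_nonneg n (-x) (by linarith))
    rw [← Complex.norm_conj]
    congr 1
    simp [← Complex.exp_conj]

variable {N M : ℕ → ℕ} {h : ∀ n, N n ≤ M n}

theorem tendsto_sum_moments (hNpos : ∀ n, 1 ≤ N n) (hN : Tendsto N atTop atTop)
    (hMN : Tendsto (fun n => M n - N n) atTop atTop) {l : ℕ} (c : Fin l → ℂ) (K : ℕ) :
    Tendsto (fun n => ∑ m ∈ Finset.range (2 * K), Complex.I ^ m / (m.factorial : ℂ) *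
        ((∫ z, linForm c z ^ m ∂(gasLaw (N n) (M n) (h n)) : ℝ) : ℂ)) atTop
      (nhds (∑ q ∈ Finset.range K,
        (-((linFormVariance c / 2 : ℝ) : ℂ)) ^ q / (q.factorial : ℂ))) := by
  induction K with
  | zero => simp
  | succ K ih =>
    obtain ⟨h1, h2⟩ := tendsto_integral_linForm_pow (h := h) hNpos hN hMN c K
    have h3 := ((Complex.continuous_ofReal.tendsto _).comp h1).const_mul
      (Complex.I ^ (2 * K) / ((2 * K).factorial : ℂ))
    have h4 := ((Complex.continuous_ofReal.tendsto _).comp h2).const_mul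
      (Complex.I ^ (2 * K + 1) / ((2 * K + 1).factorial : ℂ))
    have h5 := (ih.add h3).add h4
    simp_rw [mul_add_one, Finset.sum_range_succ]
    convert h5 using 2
    · rfl
    · have : ((2 * K).factorial : ℂ) ≠ 0 := Nat.cast_ne_zero.2 (2 * K).factorial_ne_zero
      rw [Complex.ofReal_zero, mul_zero, add_zero, pow_mul, Complex.I_sq]
      push_cast
      rw [neg_pow ((linFormVariance c : ℂ) / 2)]
      field_simp

/-- The characteristic function of a linear form converges to that of a centered Gaussian. -/
theorem tendsto_integral_exp_linForm (hNpos : ∀ n, 1 ≤ N n) (hN : Tendsto N atTop atTop)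
    (hMN : Tendsto (fun n => M n - N n) atTop atTop) {l : ℕ} (c : Fin l → ℂ) :
    Tendsto (fun n => ∫ z, Complex.exp (Complex.I * (linForm c z : ℂ))
      ∂(gasLaw (N n) (M n) (h n))) atTop
      (nhds (Complex.exp (-((linFormVariance c / 2 : ℝ) : ℂ)))) := by
  set s : ℝ := linFormVariance c / 2 with hs
  have hE : Tendsto (fun K => ∑ q ∈ Finset.range K, (-(s : ℂ)) ^ q / (q.factorial : ℂ)) atTop
      (nhds (Complex.exp (-(s : ℂ)))) := by
    rw [Complex.exp_eq_exp_ℂ]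
    exact (NormedSpace.expSeries_div_hasSum_exp (-(s : ℂ))).tendsto_sum_nat
  have ha := FloorSemiring.tendsto_pow_div_factorial_atTop s
  rw [Metric.tendsto_nhds]
  intro ε hε
  have hε4 : 0 < ε / 4 := by positivity
  -- `K` is fixed before `n`: `s ^ K / K!` is the limit of `E[X^(2K)] / (2K)!`, which bounds the
  -- Taylor error at the even order `2K`. Finitely many moments then suffice.
  obtain ⟨K, hK1, hK2⟩ := ((Metric.tendsto_nhds.1 hE _ hε4).and
    (ha.eventually_lt_const hε4)).exists
  have h1 := Metric.tendsto_nhds.1 (tendsto_sum_moments (h := h) hNpos hN hMN c K) _ hε4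
  have h2 := ((tendsto_integral_linForm_pow (h := h) hNpos hN hMN c K).1.div_const
    ((2 * K).factorial : ℝ))
  rw [mul_div_cancel_left₀ _ (Nat.cast_ne_zero.2 (2 * K).factorial_ne_zero)] at h2
  filter_upwards [h1, h2.eventually_lt_const hK2] with n hn1 hn2
  have h3 : ∑ m ∈ Finset.range (2 * K), Complex.I ^ m / (m.factorial : ℂ) *
      ((∫ z, linForm c z ^ m ∂(gasLaw (N n) (M n) (h n)) : ℝ) : ℂ) =
      ∫ z, ∑ m ∈ Finset.range (2 * K), (Complex.I * (linForm c z : ℂ)) ^ m / (m.factorial : ℂ)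
        ∂(gasLaw (N n) (M n) (h n)) := by
    rw [integral_finsetSum _ fun _ _ => integrable_discreteGas _ _]
    refine Finset.sum_congr rfl fun m _ => ?_
    rw [← integral_complex_ofReal, ← integral_const_mul]
    congr 1
    ext z
    push_cast
    ring
  have h4 : dist (∫ z, Complex.exp (Complex.I * (linForm c z : ℂ))
      ∂(gasLaw (N n) (M n) (h n))) (∑ m ∈ Finset.range (2 * K),
        Complex.I ^ m / (m.factorial : ℂ) *
        ((∫ z, linForm c z ^ m ∂(gasLaw (N n) (M n) (h n)) : ℝ) : ℂ)) ≤
      (∫ z, linForm c z ^ (2 * K) ∂(gasLaw (N n) (M n) (h n))) / (2 * K).factorial := by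
    rw [h3, dist_eq_norm, ← integral_sub (integrable_discreteGas _ _)
      (integrable_discreteGas _ _), ← integral_div]
    refine (norm_integral_le_integral_norm _).trans ?_
    refine integral_mono (integrable_discreteGas _ _) (integrable_discreteGas _ _) fun z => ?_
    have := norm_exp_I_mul_sub_sum_le (2 * K) (linForm c z)
    rwa [(even_two_mul K).pow_abs] at this
  refine (dist_triangle4 _ _ _ _).trans_lt (lt_of_lt_of_le
    (add_lt_add (add_lt_add (h4.trans_lt hn2) hn1) hK1) ?_)
  linarith

end charFun
end LogGas

namespace LogGas

/-! ### The Gaussian limit and its characteristic function. -/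

section limit

theorem measurable_complex_mk : Measurable fun p : ℝ × ℝ => (⟨p.1, p.2⟩ : ℂ) :=
  Complex.measurableEquivRealProd.symm.measurable

theorem charFun_stdComplexGaussian (t : ℂ) :
    charFun stdComplexGaussian t = Complex.exp (-((‖t‖ ^ 2 / 4 : ℝ) : ℂ)) := by
  have h1 : ∀ p : ℝ × ℝ, Complex.exp ((inner ℝ (⟨p.1, p.2⟩ : ℂ) t : ℝ) * Complex.I) =
      Complex.exp (t.re * p.1 * Complex.I) * Complex.exp (t.im * p.2 * Complex.I) := by
    intro p
    rw [← Complex.exp_add, Complex.inner]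
    congr 1
    simp
    ring
  rw [charFun_apply, stdComplexGaussian, integral_map measurable_complex_mk.aemeasurable
    (by fun_prop)]
  simp_rw [h1]
  rw [integral_prod_mul (fun x : ℝ => Complex.exp (t.re * x * Complex.I))
    (fun x : ℝ => Complex.exp (t.im * x * Complex.I)), ← charFun_apply_real,
    ← charFun_apply_real, charFun_gaussianReal, charFun_gaussianReal, ← Complex.exp_add,
    ← Complex.normSq_eq_norm_sq, Complex.normSq_apply]
  congr 1
  push_cast
  ring

/-- The `1 / 2` compensates the factor `2` in `linForm`. The inner product is the real one, so `t`
tests real and imaginary parts jointly. -/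
theorem inner_toLp_powerSum {N M l : ℕ} (t : PiLp 2 fun _ : Fin l => ℂ)
    (z : Fin N → discreteCircle M) :
    inner ℝ (WithLp.toLp 2 fun j : Fin l => powerSum ((j : ℕ) + 1) z) t =
      linForm (fun j => (starRingEnd ℂ) (t j) / 2) z := by
  rw [PiLp.inner_apply, linForm]
  refine Finset.sum_congr rfl fun j _ => ?_
  simp only [Complex.inner]
  simp
  ring

variable {Ω : Type*} [MeasurableSpace Ω] {P : Measure Ω} [IsProbabilityMeasure P]
    {Z : ℕ+ → Ω → ℂ}

theorem charFun_map_gaussianVector (hZlaw : ∀ j, HasLaw (Z j) stdComplexGaussian P)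
    (hZind : iIndepFun Z P) {l : ℕ} (t : PiLp 2 fun _ : Fin l => ℂ) :
    charFun (P.map fun ω => WithLp.toLp 2 fun j : Fin l =>
        ((√((j : ℝ) + 1) : ℝ) : ℂ) * Z (Nat.succPNat j) ω) t =
      Complex.exp (-((linFormVariance (fun j => (starRingEnd ℂ) (t j) / 2) / 2 : ℝ) : ℂ)) := by
  have hm : ∀ j, AEMeasurable (Z j) P := fun j => (hZlaw j).aemeasurable
  have hinj : Function.Injective fun j : Fin l => Nat.succPNat j := fun a b hab =>
    Fin.ext (Nat.succPNat_injective hab)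
  have h1 : iIndepFun (fun (j : Fin l) ω => ((√((j : ℝ) + 1) : ℝ) : ℂ) * Z (Nat.succPNat j) ω) P :=
    (hZind.precomp hinj).comp (fun (j : Fin l) (w : ℂ) => ((√((j : ℝ) + 1) : ℝ) : ℂ) * w)
      fun j => by fun_prop
  rw [(iIndepFun_iff_charFun_pi fun j => (hm _).const_mul _).1 h1, linFormVariance]
  have h2 : ∀ j : Fin l, charFun (P.map fun ω =>
      ((√((j : ℝ) + 1) : ℝ) : ℂ) * Z (Nat.succPNat j) ω) (t j) =
      Complex.exp (-((((j : ℝ) + 1) * ‖t j‖ ^ 2 / 4 : ℝ) : ℂ)) := by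
    intro j
    simp_rw [← Complex.real_smul]
    rw [charFun_map_smul_comp (hm _), (hZlaw _).map_eq, charFun_stdComplexGaussian, norm_smul,
      mul_pow, Real.norm_eq_abs, sq_abs, Real.sq_sqrt (by positivity)]
  simp_rw [h2]
  rw [← Complex.exp_sum, Finset.sum_neg_distrib, ← Complex.ofReal_sum]
  congr 3
  rw [mul_div_cancel_left₀ _ two_ne_zero]
  refine Finset.sum_congr rfl fun j _ => ?_
  rw [norm_div, Complex.norm_conj]
  norm_num
  ring

end limit

end LogGas

open LogGas

theorem mainTheorem6 {Ω : Type*} [MeasurableSpace Ω] (P : Measure Ω) [IsProbabilityMeasure P]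
    (Z : ℕ+ → Ω → ℂ) (hZlaw : ∀ j, HasLaw (Z j) stdComplexGaussian P) (hZind : iIndepFun Z P)
    (N M : ℕ → ℕ) (hNpos : ∀ n, 1 ≤ N n) (hNM : ∀ n, N n ≤ M n)
    (hN : Tendsto N atTop atTop) (hMN : Tendsto (fun n => M n - N n) atTop atTop)
    (l : ℕ) :
    TendstoInDistribution
      (fun n (z : Fin (N n) → discreteCircle (M n)) (j : Fin l) => powerSum ((j : ℕ) + 1) z)
      atTop
      (fun ω (j : Fin l) => ((√((j : ℝ) + 1) : ℝ) : ℂ) * Z (Nat.succPNat j) ω)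
      (fun n => (discreteGas (N n) (M n) (hNM n) : Measure _)) P := by
  have hm : ∀ j, AEMeasurable (Z j) P := fun j => (hZlaw j).aemeasurable
  -- Characteristic functions require an inner product, so convergence is proved in the Euclidean
  -- space `PiLp 2` and transported back by continuity.
  have key : TendstoInDistribution
      (fun n (z : Fin (N n) → discreteCircle (M n)) =>
        WithLp.toLp 2 fun j : Fin l => powerSum ((j : ℕ) + 1) z)
      atTop
      (fun ω => WithLp.toLp 2 fun j : Fin l =>
        ((√((j : ℝ) + 1) : ℝ) : ℂ) * Z (Nat.succPNat j) ω)
      (fun n => gasLaw (N n) (M n) (hNM n)) P := by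
    refine ⟨fun n => (measurable_of_finite _).aemeasurable, ?_, ?_⟩
    · exact (WithLp.measurable_toLp 2 _).comp_aemeasurable
        (aemeasurable_pi_lambda _ fun j => (hm _).const_mul _)
    · refine ProbabilityMeasure.tendsto_of_tendsto_charFun fun t => ?_
      simp only [ProbabilityMeasure.coe_mk]
      rw [charFun_map_gaussianVector hZlaw hZind]
      refine (tendsto_integral_exp_linForm (h := hNM) hNpos hN hMN _).congr fun n => ?_
      rw [charFun_apply, integral_map (measurable_of_finite _).aemeasurable (by fun_prop)]
      simp_rw [inner_toLp_powerSum, mul_comm Complex.I]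
  exact key.continuous_comp (PiLp.continuous_ofLp 2 _)
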